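/- Let $d$ be a dimension, let $X_1,X_2,\dots$ be independent random vectors in $\mathbb{R}^d$, defined on a common probability space, with the same law $P$, and let $P_n=\frac1n\sum_{i\le n}\delta_{X_i}$ be the empirical measures. Let $\mathbb{S}_{d-1}$ be the Euclidean unit sphere and $\Delta=[\alpha^-,\alpha^+]\subset[1/2,1)$ with $\alpha^-\le\alpha^+$. For $O\in\mathbb{R}^d$, $u\in\mathbb{S}_{d-1}$, $y\in\mathbb{R}$ and $\alpha\in\Delta$ put $$H(O,u,y)=\{x\in\mathbb{R}^d:\langle x-O,u\rangle\le y\},\qquad Y(O,u,\alpha)=\inf\{y\in\mathbb{R}:P(H(O,u,y))\ge\alpha\},$$ $$Q_\alpha(O)=\{O+Y(O,u,\alpha)\,u: u\in\mathbb{S}_{d-1}\},\qquad \mathcal{Y}_\Delta(O,u)=\{y\in\mathbb{R}:P(H(O,u,y))\in\Delta\},$$ and let $Y_n(O,u,\alpha)$ and $Q_{n,\alpha}(O)$ be defined in the same way with $P_n$ in place of $P$. Consider the conditions * $(P-)$: $P(\{x\in\mathbb{R}^d:\langle x,u\rangle=Y(0,u,\alpha)\})=0$ for all $u\in\mathbb{S}_{d-1}$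 and $\alpha\in\Delta$; * $(P+)$: $P(H(O,u,z)\setminus H(O,u,y))>0$ for all $O\in\mathbb{R}^d$, $u\in\mathbb{S}_{d-1}$ and all $y<z$ in $\mathcal{Y}_\Delta(O,u)$. Assume $(P-)$. Then $(P+)$ holds if and only if $$\lim_{n\to\infty}\ \sup_{O\in\mathbb{R}^d}\ \sup_{u\in\mathbb{S}_{d-1}}\ \sup_{\alpha\in\Delta}\ |Y_n(O,u,\alpha)-Y(O,u,\alpha)|=0\quad\text{a.s.}$$ Moreover, if $(P-)$ and $(P+)$ hold, then $$\lim_{n\to\infty}\ \sup_{O\in\mathbb{R}^d}\ \sup_{\alpha\in\Delta}\ d_H\big(Q_{n,\alpha}(O),Q_\alpha(O)\big)=0\quad\text{a.s.},$$ where $d_H$ denotes the Hausdorff distance. -/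

import Mathlib

open MeasureTheory ProbabilityTheory Filter Topology
open scoped ENNReal

noncomputable section

namespace QuantileSurface

/-- The closed half-space at signed distance `y` from `O` in the direction `u`. -/
def halfSpace {d : ℕ} (O u : EuclideanSpace ℝ (Fin d)) (y : ℝ) :
    Set (EuclideanSpace ℝ (Fin d)) :=
  {x | inner ℝ (x - O) u ≤ y}

/-- The hyperband `H(O,u,y,z) = H(O,u,z) \ H(O,u,y)`. -/
def hyperband {d : ℕ} (O u : EuclideanSpace ℝ (Fin d)) (y z : ℝ) :
    Set (EuclideanSpace ℝ (Fin d)) :=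
  halfSpace O u z \ halfSpace O u y

/-- The `u`-directional `α`-th quantile range `Y(O,u,α)` of the law `μ`, seen from `O`.
For a probability measure and `0 < α < 1` the set is nonempty and bounded below. -/
def quantileRange {d : ℕ} (μ : Measure (EuclideanSpace ℝ (Fin d)))
    (O u : EuclideanSpace ℝ (Fin d)) (α : ℝ) : ℝ :=
  sInf {y : ℝ | α ≤ μ.real (halfSpace O u y)}

/-- The `u`-directional `α`-th quantile point seen from `O`. -/
def quantilePoint {d : ℕ} (μ : Measure (EuclideanSpace ℝ (Fin d)))
    (O u : EuclideanSpace ℝ (Fin d)) (α : ℝ) : EuclideanSpace ℝ (Fin d) :=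
  O + quantileRange μ O u α • u

/-- The `α`-th quantile set (surface) seen from `O`: all quantile points over unit directions. -/
def quantileSurface {d : ℕ} (μ : Measure (EuclideanSpace ℝ (Fin d)))
    (O : EuclideanSpace ℝ (Fin d)) (α : ℝ) : Set (EuclideanSpace ℝ (Fin d)) :=
  {q | ∃ u ∈ Metric.sphere (0 : EuclideanSpace ℝ (Fin d)) 1, q = quantilePoint μ O u α}

/-- The set of admissible distances: those `y` with `P(H(O,u,y)) ∈ [αm, αp]`. -/
def admissibleRanges {d : ℕ} (P : Measure (EuclideanSpace ℝ (Fin d))) (αm αp : ℝ)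
    (O u : EuclideanSpace ℝ (Fin d)) : Set ℝ :=
  {y : ℝ | P.real (halfSpace O u y) ∈ Set.Icc αm αp}

/-- Condition (P−): every quantile hyperplane of order in `[αm, αp]` is `P`-null. -/
def NullHyperplanes {d : ℕ} (P : Measure (EuclideanSpace ℝ (Fin d))) (αm αp : ℝ) : Prop :=
  ∀ u ∈ Metric.sphere (0 : EuclideanSpace ℝ (Fin d)) 1, ∀ α ∈ Set.Icc αm αp,
    P {x | inner ℝ x u = quantileRange P 0 u α} = 0

/-- Condition (P+): every hyperband between two distinct admissible distances has positive mass. -/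
def PositiveHyperbands {d : ℕ} (P : Measure (EuclideanSpace ℝ (Fin d))) (αm αp : ℝ) : Prop :=
  ∀ O : EuclideanSpace ℝ (Fin d), ∀ u ∈ Metric.sphere (0 : EuclideanSpace ℝ (Fin d)) 1,
    ∀ y ∈ admissibleRanges P αm αp O u, ∀ z ∈ admissibleRanges P αm αp O u,
      y < z → 0 < P (hyperband O u y z)

/-- The empirical measure `P_n` of the first `n` observations `X 0 ω, …, X (n - 1) ω`. -/
def empiricalLaw {d : ℕ} {Ω : Type*} (X : ℕ → Ω → EuclideanSpace ℝ (Fin d)) (n : ℕ) (ω : Ω) :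
    Measure (EuclideanSpace ℝ (Fin d)) :=
  (n : ℝ≥0∞)⁻¹ • ∑ i ∈ Finset.range n, Measure.dirac (X i ω)

end QuantileSurface

end

/-! Moving `O` subtracts `⟨O,u⟩` from the quantile range under any probability law, so `O` cancels
from the error and only the compact set of pairs `(u, α)` remains. Under (P+) the directional
distribution function exceeds `α` strictly to the right of its `α`-quantile, so that quantile is
unique. Almost surely, `liminf P_n(G) ≥ P(G)` for all open `G` at once; with uniqueness this gives
convergence along converging `(u, α)` (`tendsto_quantileRange`), hence uniform convergence.
Conversely, if the mass stays at a level `α` from `y` to `z`, then `Y(O,u,α) ≤ y`, and uniform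
convergence would force `P_n(H(O,u,z)) ≥ α` eventually, almost surely. But `n (P_n(H) - α)` is a
centred random walk with steps bounded away from zero, which cannot stay nonnegative
(`not_ae_eventually_sum_nonneg`). -/

namespace QuantileSurface

/-! ### Half-spaces and directional quantiles -/

section HalfSpace

variable {d : ℕ} {μ : Measure (EuclideanSpace ℝ (Fin d))} {O u : EuclideanSpace ℝ (Fin d)}
  {y z α : ℝ}

lemma measurableSet_halfSpace (O u : EuclideanSpace ℝ (Fin d)) (y : ℝ) :
    MeasurableSet (halfSpace O u y) :=
  (isClosed_le (by fun_prop) continuous_const).measurableSet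

lemma halfSpace_subset_halfSpace (h : y ≤ z) : halfSpace O u y ⊆ halfSpace O u z :=
  fun _ hx => le_trans hx h

lemma halfSpace_eq_halfSpace_zero (O u : EuclideanSpace ℝ (Fin d)) (y : ℝ) :
    halfSpace O u y = halfSpace 0 u (y + inner ℝ O u) := by
  ext x
  simp [halfSpace, inner_sub_left]

lemma measureReal_halfSpace_eq_cdf [IsProbabilityMeasure μ] :
    μ.real (halfSpace O u y) = cdf (μ.map fun x => inner ℝ (x - O) u) y := by
  have hm : Measurable fun x : EuclideanSpace ℝ (Fin d) => (inner ℝ (x - O) u : ℝ) := by fun_prop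
  have := Measure.isProbabilityMeasure_map (μ := μ) hm.aemeasurable
  rw [cdf_eq_real, map_measureReal_apply hm measurableSet_Iic]
  rfl

/-- The quantile range is the lower adjoint of the directional distribution function. -/
lemma quantileRange_le_iff [IsProbabilityMeasure μ] (h0 : 0 < α) (h1 : α < 1) :
    quantileRange μ O u α ≤ y ↔ α ≤ μ.real (halfSpace O u y) := by
  unfold quantileRange
  simp_rw [measureReal_halfSpace_eq_cdf]
  set F := cdf (μ.map fun x => inner ℝ (x - O) u)
  have hne : {y : ℝ | α ≤ F y}.Nonempty :=
    ((tendsto_cdf_atTop _).eventually (lt_mem_nhds h1)).exists.imp fun _ h => h.le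
  obtain ⟨b, hb⟩ := ((tendsto_cdf_atBot _).eventually (gt_mem_nhds h0)).exists
  have hbdd : BddBelow {y : ℝ | α ≤ F y} :=
    ⟨b, fun y hy => le_of_not_gt fun hyb => (hb.trans_le hy).not_ge (F.mono hyb.le)⟩
  refine ⟨fun h => ?_, fun h => csInf_le hbdd h⟩
  -- `F ≥ α` holds to the right of `y`; right-continuity carries it to `y` itself.
  have hright : Tendsto F (𝓝[>] y) (𝓝 (F y)) :=
    (F.right_continuous y).tendsto.mono_left (nhdsWithin_mono _ Set.Ioi_subset_Ici_self)
  refine ge_of_tendsto hright ?_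
  filter_upwards [self_mem_nhdsWithin] with t ht
  obtain ⟨s, hs, hst⟩ := exists_lt_of_csInf_lt hne (lt_of_le_of_lt h ht)
  exact le_trans hs (F.mono hst.le)

lemma lt_quantileRange_iff [IsProbabilityMeasure μ] (h0 : 0 < α) (h1 : α < 1) :
    y < quantileRange μ O u α ↔ μ.real (halfSpace O u y) < α := by
  simpa using (quantileRange_le_iff h0 h1).not

lemma quantileRange_eq_sub_inner [IsProbabilityMeasure μ] (h0 : 0 < α) (h1 : α < 1) :
    quantileRange μ O u α = quantileRange μ 0 u α - inner ℝ O u := by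
  refine eq_of_forall_ge_iff fun y => ?_
  rw [quantileRange_le_iff h0 h1, halfSpace_eq_halfSpace_zero, sub_le_iff_le_add,
    quantileRange_le_iff h0 h1]

lemma measureReal_hyperband [IsFiniteMeasure μ] (h : y ≤ z) :
    μ.real (hyperband O u y z) = μ.real (halfSpace O u z) - μ.real (halfSpace O u y) :=
  measureReal_sdiff (halfSpace_subset_halfSpace h) (measurableSet_halfSpace O u y)

/-- This is uniqueness of the quantile: equality would make both distances admissible, with a null
band between them. -/
lemma PositiveHyperbands.lt_measureReal_halfSpace {P : Measure (EuclideanSpace ℝ (Fin d))}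
    [IsProbabilityMeasure P] {αm αp : ℝ} (hP : PositiveHyperbands P αm αp)
    (hu : u ∈ Metric.sphere (0 : EuclideanSpace ℝ (Fin d)) 1) (hα : α ∈ Set.Icc αm αp)
    (h0 : 0 < α) (h1 : α < 1) (hy : quantileRange P O u α < y) :
    α < P.real (halfSpace O u y) := by
  have hq := (quantileRange_le_iff (μ := P) (O := O) (u := u) h0 h1).1 le_rfl
  refine lt_of_le_of_ne ((quantileRange_le_iff h0 h1).1 hy.le) fun heq => ?_
  have hle := measureReal_mono (μ := P) (halfSpace_subset_halfSpace (O := O) (u := u) hy.le)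
  have hpos := hP O u hu (quantileRange P O u α) (by
    rwa [admissibleRanges, Set.mem_ofPred_eq, le_antisymm (hle.trans heq.ge) hq]) y
    (by rwa [admissibleRanges, Set.mem_ofPred_eq, ← heq]) hy
  have hband := measureReal_hyperband (μ := P) (O := O) (u := u) hy.le
  have : 0 < P.real (hyperband O u (quantileRange P O u α) y) :=
    ENNReal.toReal_pos hpos.ne' (measure_ne_top _ _)
  linarith

end HalfSpace

/-! ### Deterministic convergence of quantiles -/

section Convergence

variable {d : ℕ}

/-- Truncation is needed because nearby directions give uniformly close inner products only on
bounded sets. -/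
lemma exists_lt_measureReal_inter_ball {E : Type*} [SeminormedAddCommGroup E] [MeasurableSpace E]
    (μ : Measure E) [IsFiniteMeasure μ] (U : Set E) {c : ℝ} (hc : c < μ.real U) :
    ∃ R : ℝ, 0 < R ∧ c < μ.real (U ∩ Metric.ball 0 R) := by
  have hmono : Monotone fun n : ℕ => U ∩ Metric.ball (0 : E) (n : ℝ) := fun m n h =>
    Set.inter_subset_inter_right _ (Metric.ball_subset_ball (by exact_mod_cast h))
  have hlim := tendsto_measure_iUnion_atTop (μ := μ) hmono
  rw [← Set.inter_iUnion, Metric.iUnion_ball_nat, Set.inter_univ] at hlim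
  have hlim' := (ENNReal.tendsto_toReal (measure_ne_top μ U)).comp hlim
  obtain ⟨n, hn, hn0⟩ :=
    ((hlim'.eventually (lt_mem_nhds hc)).and (eventually_gt_atTop 0)).exists
  exact ⟨n, by exact_mod_cast hn0, hn⟩

/-- Quantile ranges converge along any family of laws that is asymptotically at least `P` on
open sets, with converging directions and orders, provided the limit quantile is unique. -/
theorem tendsto_quantileRange {ι : Type*} {l : Filter ι}
    {μ : ι → Measure (EuclideanSpace ℝ (Fin d))} {P : Measure (EuclideanSpace ℝ (Fin d))}
    [IsProbabilityMeasure P] (hμ : ∀ᶠ i in l, IsProbabilityMeasure (μ i))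
    (hopen : ∀ G, IsOpen G → ∀ c < P.real G, ∀ᶠ i in l, c < (μ i).real G)
    {v : ι → EuclideanSpace ℝ (Fin d)} {u : EuclideanSpace ℝ (Fin d)} (hv : Tendsto v l (𝓝 u))
    {a : ι → ℝ} {α : ℝ} (ha : Tendsto a l (𝓝 α)) (h0 : 0 < α) (h1 : α < 1)
    (hstrict : ∀ y, quantileRange P 0 u α < y → α < P.real (halfSpace 0 u y)) :
    Tendsto (fun i => quantileRange (μ i) 0 (v i) (a i)) l (𝓝 (quantileRange P 0 u α)) := by
  set q := quantileRange P 0 u α with hq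
  have hinner : ∀ R > 0, ∀ ε > 0, ∀ᶠ i in l, ∀ x ∈ Metric.ball (0 : EuclideanSpace ℝ (Fin d)) R,
      |inner ℝ x (v i) - inner ℝ x u| < ε := by
    intro R hR ε hε
    filter_upwards [Metric.tendsto_nhds.1 hv (ε / R) (by positivity)] with i hi x hx
    rw [← inner_sub_right]
    rw [dist_eq_norm, lt_div_iff₀ hR] at hi
    rw [mem_ball_zero_iff] at hx
    calc |inner ℝ x (v i - u)| ≤ ‖x‖ * ‖v i - u‖ := abs_real_inner_le_norm _ _
      _ ≤ R * ‖v i - u‖ := by gcongr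
      _ < ε := by linarith
  have ha0 := ha.eventually (lt_mem_nhds h0)
  have ha1 := ha.eventually (gt_mem_nhds h1)
  rw [tendsto_order]
  constructor
  · intro b hb
    obtain ⟨m, hbm, hmq⟩ := exists_between hb
    have hm : P.real (halfSpace 0 u m) < α := (lt_quantileRange_iff h0 h1).1 hmq
    -- Only lower bounds on open sets are available, so the half-space is bounded above through its
    -- complement.
    have hU : 1 - α < P.real (halfSpace 0 u m)ᶜ := by
      rw [probReal_compl_eq_one_sub (measurableSet_halfSpace 0 u m)]; linarith
    obtain ⟨R, hR, hcR⟩ := exists_lt_measureReal_inter_ball P _ hU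
    obtain ⟨c, hc, hcR⟩ := exists_between hcR
    have hG : IsOpen ((halfSpace 0 u m)ᶜ ∩ Metric.ball 0 R) :=
      (isClosed_le (by fun_prop) continuous_const).isOpen_compl.inter Metric.isOpen_ball
    filter_upwards [hμ, ha0, ha1, hopen _ hG c hcR, hinner R hR (m - b) (by linarith),
      ha.eventually (lt_mem_nhds (show 1 - c < α by linarith))] with i hi h0i h1i hGi hxi hai
    rw [lt_quantileRange_iff h0i h1i]
    have hsub : (halfSpace 0 u m)ᶜ ∩ Metric.ball 0 R ⊆ (halfSpace 0 (v i) b)ᶜ := by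
      rintro x ⟨hx, hxR⟩ hxb
      have := (abs_lt.1 (hxi x hxR)).1
      simp only [halfSpace, sub_zero, Set.mem_compl_iff, Set.mem_ofPred_eq, not_le] at hx hxb
      linarith
    have := measureReal_mono (μ := μ i) hsub
    rw [probReal_compl_eq_one_sub (measurableSet_halfSpace 0 (v i) b)] at this
    linarith
  · intro b hb
    obtain ⟨b₁, hqb, hb₁⟩ := exists_between hb
    obtain ⟨m, hqm, hmb⟩ := exists_between hqb
    obtain ⟨R, hR, hcR⟩ := exists_lt_measureReal_inter_ball P {x | inner ℝ x u < b₁}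
      ((hstrict m hqm).trans_le (measureReal_mono fun x hx => by
        simp only [halfSpace, sub_zero, Set.mem_ofPred_eq] at hx ⊢
        linarith))
    obtain ⟨c, hc, hcR⟩ := exists_between hcR
    obtain ⟨b₂, hb₂, hbb⟩ := exists_between hb₁
    have hG : IsOpen ({x | inner ℝ x u < b₁} ∩ Metric.ball (0 : EuclideanSpace ℝ (Fin d)) R) :=
      (isOpen_lt (by fun_prop) continuous_const).inter Metric.isOpen_ball
    filter_upwards [hμ, ha0, ha1, hopen _ hG c hcR, hinner R hR (b₂ - b₁) (by linarith),
      ha.eventually (gt_mem_nhds hc)] with i hi h0i h1i hGi hxi hai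
    refine LE.le.trans_lt ((quantileRange_le_iff h0i h1i).2 ?_) hbb
    refine (hai.trans hGi).le.trans (measureReal_mono ?_)
    rintro x ⟨hx, hxR⟩
    have := (abs_lt.1 (hxi x hxR)).2
    simp only [halfSpace, sub_zero, Set.mem_ofPred_eq] at hx ⊢
    linarith

/-- Locally uniform convergence of quantile ranges upgrades to uniform convergence over the
compact set of directions and orders. -/
theorem tendstoUniformlyOn_quantileRange {μ : ℕ → Measure (EuclideanSpace ℝ (Fin d))}
    {P : Measure (EuclideanSpace ℝ (Fin d))} [IsProbabilityMeasure P]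
    (hμ : ∀ᶠ n in atTop, IsProbabilityMeasure (μ n))
    (hopen : ∀ G, IsOpen G → ∀ c < P.real G, ∀ᶠ n in atTop, c < (μ n).real G)
    {αm αp : ℝ} (h0 : 0 < αm) (h1 : αp < 1) (hP : PositiveHyperbands P αm αp) :
    TendstoUniformlyOn (fun n (p : EuclideanSpace ℝ (Fin d) × ℝ) => quantileRange (μ n) 0 p.1 p.2)
      (fun p => quantileRange P 0 p.1 p.2) atTop (Metric.sphere 0 1 ×ˢ Set.Icc αm αp) := by
  have hK : IsCompact (Metric.sphere (0 : EuclideanSpace ℝ (Fin d)) 1 ×ˢ Set.Icc αm αp) :=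
    (isCompact_sphere 0 1).prod isCompact_Icc
  rw [← tendstoLocallyUniformlyOn_iff_tendstoUniformlyOn_of_compact hK,
    tendstoLocallyUniformlyOn_iff_forall_tendsto]
  rintro ⟨u, α⟩ ⟨hu, hα⟩
  have hα0 : 0 < α := h0.trans_le hα.1
  have hα1 : α < 1 := hα.2.trans_lt h1
  set l := (atTop : Filter ℕ) ×ˢ 𝓝[Metric.sphere 0 1 ×ˢ Set.Icc αm αp] (u, α)
  have hsnd : Tendsto (fun p : ℕ × EuclideanSpace ℝ (Fin d) × ℝ => p.2) l (𝓝 (u, α)) :=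
    tendsto_snd.mono_right nhdsWithin_le_nhds
  have hv := hsnd.fst_nhds
  have ha := hsnd.snd_nhds
  have hfst : Tendsto (fun p : ℕ × EuclideanSpace ℝ (Fin d) × ℝ => p.1) l atTop := tendsto_fst
  have hstrict := fun y => hP.lt_measureReal_halfSpace (O := 0) (y := y) hu hα hα0 hα1
  have hlim := tendsto_quantileRange (P := P) (l := l) (μ := fun p => μ p.1) (hfst.eventually hμ)
    (fun G hG c hc => hfst.eventually (hopen G hG c hc)) hv ha hα0 hα1 hstrict
  -- The constant family gives continuity of the limit in `(u, α)`.
  have hcont := tendsto_quantileRange (P := P) (l := l) (μ := fun _ => P)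
    (Eventually.of_forall fun _ => inferInstance) (fun G _ c hc => Eventually.of_forall fun _ => hc)
    hv ha hα0 hα1 hstrict
  exact (hcont.prodMk_nhds hlim).mono_right (nhds_le_uniformity _)

end Convergence

/-! ### Empirical measures and the strong law -/

section Empirical

variable {d : ℕ} {Ω : Type*} {X : ℕ → Ω → EuclideanSpace ℝ (Fin d)}

lemma isProbabilityMeasure_empiricalLaw {n : ℕ} (hn : n ≠ 0) (ω : Ω) :
    IsProbabilityMeasure (empiricalLaw X n ω) := by
  constructor
  simp [empiricalLaw, ENNReal.inv_mul_cancel, hn]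

lemma measureReal_empiricalLaw {A : Set (EuclideanSpace ℝ (Fin d))} (hA : MeasurableSet A)
    (n : ℕ) (ω : Ω) :
    (empiricalLaw X n ω).real A = (∑ i ∈ Finset.range n, A.indicator 1 (X i ω)) / n := by
  have h : (∑ i ∈ Finset.range n, Measure.dirac (X i ω)).real A =
      ∑ i ∈ Finset.range n, A.indicator 1 (X i ω) := by
    rw [measureReal_def, Measure.finsetSum_apply, ENNReal.toReal_sum (fun i _ => measure_ne_top _ _)]
    refine Finset.sum_congr rfl fun i _ => ?_
    rw [Measure.dirac_apply' _ hA]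
    by_cases hx : X i ω ∈ A <;> simp [hx]
  rw [empiricalLaw, measureReal_ennreal_smul_apply, h]
  simp [div_eq_inv_mul]

variable [MeasurableSpace Ω] {Pr : Measure Ω} {P : Measure (EuclideanSpace ℝ (Fin d))}

lemma integral_indicator_comp {X : Ω → EuclideanSpace ℝ (Fin d)} (hX : Measurable X)
    (hlaw : Pr.map X = P) {A : Set (EuclideanSpace ℝ (Fin d))} (hA : MeasurableSet A) :
    ∫ ω, A.indicator (1 : EuclideanSpace ℝ (Fin d) → ℝ) (X ω) ∂Pr = P.real A := by
  rw [← hlaw, ← integral_indicator_one hA, integral_map hX.aemeasurable]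
  exact (measurable_one.indicator hA).aestronglyMeasurable

variable [IsProbabilityMeasure Pr]

lemma integrable_indicator_comp {X : Ω → EuclideanSpace ℝ (Fin d)} (hX : Measurable X)
    {A : Set (EuclideanSpace ℝ (Fin d))} (hA : MeasurableSet A) :
    Integrable (fun ω => A.indicator (1 : EuclideanSpace ℝ (Fin d) → ℝ) (X ω)) Pr :=
  (integrable_const (1 : ℝ)).indicator (hX hA)

lemma ae_tendsto_measureReal_empiricalLaw (hX : ∀ i, Measurable (X i)) (hindep : iIndepFun X Pr)
    (hlaw : ∀ i, Pr.map (X i) = P) {A : Set (EuclideanSpace ℝ (Fin d))} (hA : MeasurableSet A) :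
    ∀ᵐ ω ∂Pr, Tendsto (fun n => (empiricalLaw X n ω).real A) atTop (𝓝 (P.real A)) := by
  have hf : Measurable (A.indicator (1 : EuclideanSpace ℝ (Fin d) → ℝ)) :=
    measurable_one.indicator hA
  have hid : ∀ i, IdentDistrib (X i) (X 0) Pr Pr := fun i =>
    ⟨(hX i).aemeasurable, (hX 0).aemeasurable, by rw [hlaw, hlaw]⟩
  have := strong_law_ae_real (fun i ω => A.indicator (1 : EuclideanSpace ℝ (Fin d) → ℝ) (X i ω))
    (integrable_indicator_comp (hX 0) hA) (fun i j hij => (hindep.indepFun hij).comp hf hf) fun i => (hid i).comp hf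
  filter_upwards [this] with ω hω
  rw [integral_indicator_comp (hX 0) (hlaw 0) hA] at hω
  simpa only [measureReal_empiricalLaw hA] using hω

/-- Almost surely, the empirical measures are asymptotically at least `P` on every open set. -/
theorem ae_forall_isOpen_eventually_lt_empiricalLaw (hX : ∀ i, Measurable (X i))
    (hindep : iIndepFun X Pr) (hlaw : ∀ i, Pr.map (X i) = P) [IsFiniteMeasure P] :
    ∀ᵐ ω ∂Pr, ∀ G, IsOpen G → ∀ c < P.real G, ∀ᶠ n in atTop, c < (empiricalLaw X n ω).real G := by
  obtain ⟨B, hBc, -, hB⟩ :=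
    TopologicalSpace.exists_countable_basis (EuclideanSpace ℝ (Fin d))
  have : Countable B := hBc
  have hmeas : ∀ s : Finset B, MeasurableSet (⋃ b ∈ s, (b : Set (EuclideanSpace ℝ (Fin d)))) :=
    fun s => s.measurableSet_biUnion fun b _ => (hB.isOpen b.2).measurableSet
  -- Finite unions of basic sets are countably many, so one null set serves all of them; they
  -- exhaust any open `G` in mass.
  filter_upwards [ae_all_iff.2 fun s : Finset B =>
    ae_tendsto_measureReal_empiricalLaw hX hindep hlaw (hmeas s)] with ω hω G hG c hc
  have hGU : G = ⋃ b : {b : B // (b : Set (EuclideanSpace ℝ (Fin d))) ⊆ G}, b.1.1 := by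
    conv_lhs => rw [hB.open_eq_sUnion' hG]
    ext x
    simp only [Set.mem_sUnion, Set.mem_ofPred_eq, Set.mem_iUnion]
    exact ⟨fun ⟨t, ⟨ht, htG⟩, hx⟩ => ⟨⟨⟨t, ht⟩, htG⟩, hx⟩, fun ⟨b, hx⟩ => ⟨_, ⟨b.1.2, b.2⟩, hx⟩⟩
  obtain ⟨s, hsG, hs⟩ : ∃ s : Finset B, (⋃ b ∈ s, (b : Set (EuclideanSpace ℝ (Fin d)))) ⊆ G ∧
      c < P.real (⋃ b ∈ s, (b : Set (EuclideanSpace ℝ (Fin d)))) := by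
    have hmono : Monotone fun s : Finset {b : B // (b : Set (EuclideanSpace ℝ (Fin d))) ⊆ G} =>
        ⋃ b ∈ s, (b.1.1 : Set (EuclideanSpace ℝ (Fin d))) :=
      fun s t hst => Set.biUnion_subset_biUnion_left hst
    have hlim := tendsto_measure_iUnion_atTop (μ := P) hmono
    rw [← Set.iUnion_eq_iUnion_finset, ← hGU] at hlim
    obtain ⟨s, hs⟩ := (((ENNReal.tendsto_toReal (measure_ne_top P G)).comp hlim).eventually
      (lt_mem_nhds hc)).exists
    refine ⟨s.map (Function.Embedding.subtype _), ?_, ?_⟩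
    · simp only [Finset.mem_map, Set.iUnion_subset_iff]
      rintro _ ⟨b, -, rfl⟩
      exact b.2
    · have hmap : (⋃ b ∈ s.map (Function.Embedding.subtype _), (b : Set _)) =
          ⋃ b ∈ s, (b.1.1 : Set (EuclideanSpace ℝ (Fin d))) := by
        ext x
        simp
      rw [hmap]
      exact hs
  filter_upwards [(hω s).eventually (lt_mem_nhds hs), eventually_ne_atTop 0] with n hn hn0
  have := isProbabilityMeasure_empiricalLaw (X := X) hn0 ω
  exact hn.trans_le (measureReal_mono hsG)

end Empirical

/-! ### Oscillation of centred random walks -/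

section RandomWalk

variable {Ω : Type*} [MeasurableSpace Ω] {Pr : Measure Ω}

/-- A centered random walk with bounded independent steps that are bounded away from zero is not
almost surely eventually nonnegative. -/
theorem not_ae_eventually_sum_nonneg [IsProbabilityMeasure Pr] {ξ : ℕ → Ω → ℝ}
    (hξ : ∀ i, Measurable (ξ i)) (hindep : iIndepFun ξ Pr) (hmean : ∀ i, ∫ ω, ξ i ω ∂Pr = 0)
    {C : NNReal} (hC : ∀ i ω, |ξ i ω| ≤ C) {c : ℝ} (hc : 0 < c) (hc' : ∀ i ω, c ≤ |ξ i ω|) :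
    ¬ ∀ᵐ ω ∂Pr, ∀ᶠ n in atTop, 0 ≤ ∑ i ∈ Finset.range n, ξ i ω := by
  intro hev
  have hξs : ∀ i, StronglyMeasurable (ξ i) := fun i => (hξ i).stronglyMeasurable
  have hint : ∀ i, Integrable (ξ i) Pr := fun i =>
    Integrable.of_bound (hξs i).aestronglyMeasurable C (ae_of_all _ (hC i))
  set ℱ := Filtration.natural ξ hξs
  set S : ℕ → Ω → ℝ := fun n => ∑ i ∈ Finset.range (n + 1), ξ i with hS
  have hdiff : ∀ n, S (n + 1) - S n = ξ (n + 1) := fun n => by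
    simp [hS, Finset.sum_range_succ _ (n + 1)]
  have hmart : Martingale S ℱ Pr := by
    refine martingale_of_condExp_sub_eq_zero_nat (fun n => ?_)
      (fun n => integrable_finsetSum' _ fun i _ => hint i) fun n => ?_
    · refine Finset.stronglyMeasurable_sum _ fun i hi => ?_
      exact (Filtration.stronglyAdapted_natural hξs i).mono
        (ℱ.mono (Nat.lt_succ_iff.1 (Finset.mem_range.1 hi)))
    · rw [hdiff]
      filter_upwards [hindep.condExp_natural_ae_eq_of_lt hξs n.lt_succ_self] with ω hω
      rw [hω, hmean]
      rfl
  have hbdd : ∀ᵐ ω ∂Pr, ∀ n, |S (n + 1) ω - S n ω| ≤ C :=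
    ae_of_all _ fun ω n => by
      rw [← Pi.sub_apply, hdiff]
      exact hC _ _
  have hfalse : ∀ᵐ ω ∂Pr, False := by
    filter_upwards [hev, hmart.bddAbove_range_iff_bddBelow_range hbdd,
      hmart.submartingale.bddAbove_iff_exists_tendsto hbdd] with ω hω h1 h2
    have hbelow : BddBelow (Set.range fun n => S n ω) := by
      refine IsBoundedUnder.bddBelow_range ⟨0, ?_⟩
      rw [eventually_map]
      filter_upwards [(tendsto_add_atTop_nat 1).eventually hω] with n hn
      simpa [hS] using hn
    -- With bounded increments, bounded below implies bounded above, hence convergent; the steps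
    -- would then tend to zero.
    obtain ⟨b, hb⟩ := h2.1 (h1.2 hbelow)
    have hzero := (((tendsto_add_atTop_iff_nat 1).2 hb).sub hb).abs
    rw [sub_self, abs_zero] at hzero
    refine hc.not_ge (ge_of_tendsto' hzero fun n => ?_)
    rw [← Pi.sub_apply, hdiff]
    exact hc' _ _
  exact hfalse.exists.elim fun _ h => h

end RandomWalk

/-! ### The equivalence and the Hausdorff bound -/

section Main

variable {d : ℕ} {Ω : Type*} [MeasurableSpace Ω] {Pr : Measure Ω} [IsProbabilityMeasure Pr]
  {P : Measure (EuclideanSpace ℝ (Fin d))} {X : ℕ → Ω → EuclideanSpace ℝ (Fin d)}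

/-- The empirical mass of a nontrivial set falls below its true mass infinitely often, with
positive probability. -/
theorem not_ae_eventually_le_empiricalLaw (hX : ∀ i, Measurable (X i)) (hindep : iIndepFun X Pr)
    (hlaw : ∀ i, Pr.map (X i) = P) {A : Set (EuclideanSpace ℝ (Fin d))} (hA : MeasurableSet A)
    (h0 : 0 < P.real A) (h1 : P.real A < 1) :
    ¬ ∀ᵐ ω ∂Pr, ∀ᶠ n in atTop, P.real A ≤ (empiricalLaw X n ω).real A := by
  intro hev
  set α := P.real A
  have hf : Measurable fun x => A.indicator (1 : EuclideanSpace ℝ (Fin d) → ℝ) x - α :=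
    (measurable_one.indicator hA).sub_const α
  have hval : ∀ x, A.indicator (1 : EuclideanSpace ℝ (Fin d) → ℝ) x = 0 ∨
      A.indicator (1 : EuclideanSpace ℝ (Fin d) → ℝ) x = 1 := fun x => by
    by_cases hx : x ∈ A <;> simp [hx]
  refine not_ae_eventually_sum_nonneg (Pr := Pr)
    (ξ := fun i ω => A.indicator (1 : EuclideanSpace ℝ (Fin d) → ℝ) (X i ω) - α)
    (fun i => hf.comp (hX i)) (hindep.comp _ fun _ => hf) (fun i => ?_) (C := 1) (fun i ω => ?_)
    -- The steps take only the values `-α` and `1 - α`.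
    (c := min α (1 - α)) (lt_min h0 (by linarith)) (fun i ω => ?_) ?_
  · rw [integral_sub (integrable_indicator_comp (hX i) hA) (integrable_const α),
      integral_indicator_comp (hX i) (hlaw i) hA]
    simp [α]
  · rw [NNReal.coe_one, abs_le]
    rcases hval (X i ω) with h | h <;> rw [h] <;> constructor <;> linarith
  · rcases hval (X i ω) with h | h <;> rw [h]
    · rw [zero_sub, abs_neg, abs_of_pos h0]
      exact min_le_left _ _
    · rw [abs_of_pos (by linarith)]
      exact min_le_right _ _
  · filter_upwards [hev] with ω hω
    filter_upwards [hω, eventually_gt_atTop 0] with n hn hn0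
    rw [measureReal_empiricalLaw hA, le_div_iff₀ (by exact_mod_cast hn0)] at hn
    simp only [Finset.sum_sub_distrib, Finset.sum_const, Finset.card_range, nsmul_eq_mul]
    linarith

theorem ae_tendsto_iSup_quantileRange (hX : ∀ i, Measurable (X i)) (hindep : iIndepFun X Pr)
    (hlaw : ∀ i, Pr.map (X i) = P) [IsProbabilityMeasure P] {αm αp : ℝ} (hαm : 0 < αm)
    (hαp : αp < 1) (hP : PositiveHyperbands P αm αp) :
    ∀ᵐ ω ∂Pr, Tendsto (fun n : ℕ =>
      ⨆ O : EuclideanSpace ℝ (Fin d), ⨆ u ∈ Metric.sphere (0 : EuclideanSpace ℝ (Fin d)) 1,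
      ⨆ α ∈ Set.Icc αm αp, ENNReal.ofReal
        |quantileRange (empiricalLaw X n ω) O u α - quantileRange P O u α|) atTop (𝓝 0) := by
  filter_upwards [ae_forall_isOpen_eventually_lt_empiricalLaw hX hindep hlaw] with ω hω
  have hprob : ∀ᶠ n in atTop, IsProbabilityMeasure (empiricalLaw X n ω) :=
    (eventually_ne_atTop 0).mono fun n hn => isProbabilityMeasure_empiricalLaw hn ω
  have hunif := Metric.tendstoUniformlyOn_iff.1
    (tendstoUniformlyOn_quantileRange hprob hω hαm hαp hP)
  rw [ENNReal.tendsto_nhds_zero]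
  intro ε hε
  obtain ⟨δ, -, hδ0, hδ⟩ := ENNReal.lt_iff_exists_real_btwn.1 hε
  filter_upwards [hprob, hunif δ (ENNReal.ofReal_pos.1 hδ0)] with n hn hclose
  refine iSup_le fun O => iSup₂_le fun u hu => iSup₂_le fun α hα => ?_
  have hα0 : 0 < α := hαm.trans_le hα.1
  have hα1 : α < 1 := hα.2.trans_lt hαp
  rw [quantileRange_eq_sub_inner (μ := empiricalLaw X n ω) hα0 hα1,
    quantileRange_eq_sub_inner (μ := P) hα0 hα1, sub_sub_sub_cancel_right, abs_sub_comm]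
  exact (ENNReal.ofReal_le_ofReal (hclose (u, α) ⟨hu, hα⟩).le).trans hδ.le

theorem positiveHyperbands_of_ae_tendsto (hX : ∀ i, Measurable (X i)) (hindep : iIndepFun X Pr)
    (hlaw : ∀ i, Pr.map (X i) = P) [IsProbabilityMeasure P] {αm αp : ℝ} (hαm : 0 < αm)
    (hαp : αp < 1)
    (hlim : ∀ᵐ ω ∂Pr, Tendsto (fun n : ℕ =>
      ⨆ O : EuclideanSpace ℝ (Fin d), ⨆ u ∈ Metric.sphere (0 : EuclideanSpace ℝ (Fin d)) 1,
      ⨆ α ∈ Set.Icc αm αp, ENNReal.ofReal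
        |quantileRange (empiricalLaw X n ω) O u α - quantileRange P O u α|) atTop (𝓝 0)) :
    PositiveHyperbands P αm αp := by
  intro O u hu y hy z hz hyz
  by_contra hband
  have heq : P.real (halfSpace O u z) = P.real (halfSpace O u y) := by
    rw [← sub_eq_zero, ← measureReal_hyperband hyz.le, measureReal_def,
      nonpos_iff_eq_zero.1 (not_lt.1 hband), ENNReal.toReal_zero]
  have h0 : 0 < P.real (halfSpace O u z) := hαm.trans_le hz.1
  have h1 : P.real (halfSpace O u z) < 1 := hz.2.trans_lt hαp
  refine not_ae_eventually_le_empiricalLaw hX hindep hlaw (measurableSet_halfSpace O u z) h0 h1 ?_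
  filter_upwards [hlim] with ω hω
  have hq : quantileRange P O u (P.real (halfSpace O u z)) ≤ y :=
    (quantileRange_le_iff h0 h1).2 heq.le
  -- An error of at most `z - y` keeps the empirical quantile at or below `z`.
  filter_upwards [eventually_ne_atTop 0, ENNReal.tendsto_nhds_zero.1 hω (ENNReal.ofReal (z - y))
    (ENNReal.ofReal_pos.2 (sub_pos.2 hyz))] with n hn0 hn
  have := isProbabilityMeasure_empiricalLaw (X := X) hn0 ω
  rw [← quantileRange_le_iff h0 h1]
  have hn' := (le_iSup_of_le O <| le_iSup₂_of_le u hu <|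
    le_iSup₂_of_le (P.real (halfSpace O u z)) hz le_rfl).trans hn
  rw [ENNReal.ofReal_le_ofReal_iff (sub_pos.2 hyz).le] at hn'
  linarith [(abs_le.1 hn').2]

lemma edist_quantilePoint {μ ν : Measure (EuclideanSpace ℝ (Fin d))}
    {O u : EuclideanSpace ℝ (Fin d)} (hu : u ∈ Metric.sphere (0 : EuclideanSpace ℝ (Fin d)) 1)
    (α : ℝ) : edist (quantilePoint μ O u α) (quantilePoint ν O u α) =
      ENNReal.ofReal |quantileRange μ O u α - quantileRange ν O u α| := by
  rw [quantilePoint, quantilePoint, edist_dist, dist_add_left, dist_eq_norm, ← sub_smul, norm_smul,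
    mem_sphere_zero_iff_norm.1 hu, mul_one, Real.norm_eq_abs]

/-- Pair the points of the two surfaces that share a direction. -/
lemma hausdorffEDist_quantileSurface_le (μ ν : Measure (EuclideanSpace ℝ (Fin d)))
    (O : EuclideanSpace ℝ (Fin d)) (α : ℝ) :
    Metric.hausdorffEDist (quantileSurface μ O α) (quantileSurface ν O α) ≤
      ⨆ u ∈ Metric.sphere (0 : EuclideanSpace ℝ (Fin d)) 1,
        ENNReal.ofReal |quantileRange μ O u α - quantileRange ν O u α| := by
  have hle : ∀ u ∈ Metric.sphere (0 : EuclideanSpace ℝ (Fin d)) 1,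
      edist (quantilePoint μ O u α) (quantilePoint ν O u α) ≤
        ⨆ u ∈ Metric.sphere (0 : EuclideanSpace ℝ (Fin d)) 1,
          ENNReal.ofReal |quantileRange μ O u α - quantileRange ν O u α| := fun u hu =>
    (edist_quantilePoint hu α).trans_le (le_iSup₂_of_le u hu le_rfl)
  refine Metric.hausdorffEDist_le_of_mem_edist ?_ ?_
  · rintro _ ⟨u, hu, rfl⟩
    exact ⟨_, ⟨u, hu, rfl⟩, hle u hu⟩
  · rintro _ ⟨u, hu, rfl⟩
    exact ⟨_, ⟨u, hu, rfl⟩, (edist_comm _ _).trans_le (hle u hu)⟩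

end Main

end QuantileSurface


theorem theorem3p1 {d : ℕ} {Ω : Type*} [MeasurableSpace Ω] (Pr : Measure Ω)
    [IsProbabilityMeasure Pr] (P : Measure (EuclideanSpace ℝ (Fin d)))
    (X : ℕ → Ω → EuclideanSpace ℝ (Fin d)) (hX : ∀ i, Measurable (X i))
    (hindep : iIndepFun X Pr) (hlaw : ∀ i, Pr.map (X i) = P)
    (αm αp : ℝ) (hαm : 1 / 2 ≤ αm) (hα : αm ≤ αp) (hαp : αp < 1)
    (hPminus : QuantileSurface.NullHyperplanes P αm αp) :
    (QuantileSurface.PositiveHyperbands P αm αp ↔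
      ∀ᵐ ω ∂Pr, Tendsto (fun n : ℕ =>
        ⨆ O : EuclideanSpace ℝ (Fin d),
        ⨆ u ∈ Metric.sphere (0 : EuclideanSpace ℝ (Fin d)) 1,
        ⨆ α ∈ Set.Icc αm αp,
          ENNReal.ofReal |QuantileSurface.quantileRange
              (QuantileSurface.empiricalLaw X n ω) O u α
            - QuantileSurface.quantileRange P O u α|) atTop (𝓝 0)) ∧
    (QuantileSurface.PositiveHyperbands P αm αp →
      ∀ᵐ ω ∂Pr, Tendsto (fun n : ℕ =>
        ⨆ O : EuclideanSpace ℝ (Fin d), ⨆ α ∈ Set.Icc αm αp,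
          Metric.hausdorffEDist
            (QuantileSurface.quantileSurface (QuantileSurface.empiricalLaw X n ω) O α)
            (QuantileSurface.quantileSurface P O α)) atTop (𝓝 0)) := by
  have : IsProbabilityMeasure P :=
    hlaw 0 ▸ Measure.isProbabilityMeasure_map (hX 0).aemeasurable
  have hαm0 : 0 < αm := by linarith
  refine ⟨⟨QuantileSurface.ae_tendsto_iSup_quantileRange hX hindep hlaw hαm0 hαp,
    QuantileSurface.positiveHyperbands_of_ae_tendsto hX hindep hlaw hαm0 hαp⟩, fun hP => ?_⟩
  filter_upwards [QuantileSurface.ae_tendsto_iSup_quantileRange hX hindep hlaw hαm0 hαp hP]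
    with ω hω
  refine tendsto_of_tendsto_of_tendsto_of_le_of_le tendsto_const_nhds hω
    (fun _ => bot_le) fun n => iSup_mono fun O => iSup₂_le fun α hα => ?_
  refine (QuantileSurface.hausdorffEDist_quantileSurface_le _ _ O α).trans ?_
  exact iSup₂_mono fun u _ => le_iSup₂_of_le α hα le_rfl
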